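/- **Setting.** Let $\varrho$ be the substitution $0\mapsto 02,\ 1\mapsto 32,\ 2\mapsto 01,\ 3\mapsto 31$, let $q\in\{0,1,2,3\}^{\mathbb Z}$ be a bi-infinite fixed point of $\varrho^2$ with one of the seeds $q_{-1}|q_0\in\{2|0,\,2|3,\,1|0,\,1|3\}$, and let $w\in\{\pm1\}^{\mathbb Z}$ be the binary Rudin–Shapiro word obtained from $q$ by $0,2\mapsto 1$ and $1,3\mapsto -1$. Let $\mathbb X\subset\{\pm1\}^{\mathbb Z}$ be its hull, i.e. the closure of its translation orbit in the product topology. For $n\ge 2$ and $m=(m_1,\dots,m_{n-1})\in\mathbb Z^{n-1}$, with $m_0:=0$, the balanced and the signed correlations are $$\eta^{(n)}(m)=\lim_{N\to\infty}\frac1{2N+1}\sum_{i=-N}^{N}\prod_{k=0}^{n-1}w_{i+m_k},\qquad \theta^{(n)}(m)=\lim_{N\to\infty}\frac1{2N+1}\sum_{i=-N}^{N}(-1)^i\prod_{k=0}^{n-1}w_{i+m_k},$$ and for a shift-invariant probability measure $\mu$ on $\mathbb X$ and $f:\{\pm1\}\to\mathbb R$ the $f$-weighted correlations are $$\eta_f^{(n)}(m)=\int_{\mathbb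 X} f(x_0)f(x_{m_1})\cdots f(x_{m_{n-1}})\,d\mu(x).$$ Put $\mathbb E(f)=\frac{f(1)+f(-1)}2$ and $h_f=\frac{f(1)-f(-1)}2$. For $a=4c+\ell\in\mathbb Z$ with $\ell\in\{0,1,2,3\}$ let $\varepsilon(a)=1$ if $\ell\in\{0,1\}$ and $\varepsilon(a)=(-1)^{c+\ell}$ if $\ell\in\{2,3\}$. The *$k$-point renormalisation equations* for a pair of functions $G,H:\mathbb Z^{k-1}\to\mathbb R$ are, for all $m\in\mathbb Z^{k-1}$, $$G(m)=\tfrac14\sum_{j=0}^{3}T_j(m),\qquad H(m)=\tfrac14\sum_{j=0}^{3}(-1)^jT_j(m),\qquad T_j(m)=\Bigl(\prod_{i=0}^{k-1}\varepsilon(m_i+j)\Bigr)\,F_j\bigl(\lfloor\tfrac{m_1+j}4\rfloor,\dots,\lfloor\tfrac{m_{k-1}+j}4\rfloor\bigr),$$ where $m_0=0$, and $F_j=G$ or $F_j=H$ according to whether the number of $i\in\{0,\dots,k-1\}$ with $m_i+j\equiv 2,3 \pmod 4$ is even or odd. A *renormalisation family of order $n$* consists of pairs $(G^{(k)},H^{(k)})$,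 $2\le k\le n$, such that each $(G^{(k)},H^{(k)})$ satisfies the $k$-point renormalisation equations, and $G^{(k+2)}(0,\dots,0)=G^{(k)}(0,\dots,0)$ whenever $2\le k\le n-2$. **Theorem.** There is exactly one shift-invariant probability measure $\mu$ on $\mathbb X$. For every $n\ge2$, the limits $\eta^{(n)}(m)$ and $\theta^{(n)}(m)$ exist for all $m\in\mathbb Z^{n-1}$, and the pairs $(\eta^{(k)},\theta^{(k)})$, $2\le k\le n$, form a renormalisation family of order $n$. Moreover, for every $n\geqslant 2$ and every $f:\{\pm1\}\to\mathbb R$: 1. The $n$-point correlation function of the $f$-weighted binary Rudin–Shapiro word is computed from the balanced correlations: for all $m\in\mathbb Z^{n-1}$, $$\eta_f^{(n)}(m)=\sum_{S\subseteq\{0,\dots,n-1\}}\mathbb E(f)^{\,n-|S|}\,h_f^{\,|S|}\,\langle m_s: s\in S\rangle,$$ where $m_0=0$, and for $S=\{s_0<s_1<\dots<s_{k-1}\}$ the bracket is $1$ if $k=0$, is $0$ if $k=1$, and is $\eta^{(k)}(m_{s_1}-m_{s_0},\dots,m_{s_{k-1}}-m_{s_0})$ if $k\ge2$. 2. In particular,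 $\eta_f^{(n)}$ is determined by a single value of a balanced correlation at the origin: if $(G^{(k)},H^{(k)})_{2\le k\le n}$ is any renormalisation family of order $n$, and $G^{(p)}(0,\dots,0)=\eta^{(p)}(0,\dots,0)$ for one even $p$ with $2\le p\le n$ (for even $n$ one may take $p=n$), then the formula in 1 holds for all $m$ with $G^{(k)}$ in place of $\eta^{(k)}$. -/

import Mathlib

open MeasureTheory Filter Topology

/-! ### The Rudin--Shapiro words -/

/-- The quaternary Rudin--Shapiro substitution `0 ↦ 02`, `1 ↦ 32`, `2 ↦ 01`, `3 ↦ 31`. -/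
def rsSubst : Fin 4 → Fin 2 → Fin 4 :=
  ![![0, 2], ![3, 2], ![0, 1], ![3, 1]]

/-- The action of the substitution on bi-infinite words: the letter `q i` is replaced by the
two letters at the positions `2 * i` and `2 * i + 1`. -/
def rsSubstWord (q : ℤ → Fin 4) : ℤ → Fin 4 :=
  fun i => if Even i then rsSubst (q (i / 2)) 0 else rsSubst (q (i / 2)) 1

/-- The legal seeds `2|0`, `2|3`, `1|0`, `1|3`. -/
def IsRSSeed (l r : Fin 4) : Prop := (l = 2 ∨ l = 1) ∧ (r = 0 ∨ r = 3)

/-- `q` is one of the bi-infinite quaternary Rudin--Shapiro words: it is fixed by the square of the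
substitution, and it has a legal seed at the positions `-1 | 0`. -/
def IsRSFixedPoint (q : ℤ → Fin 4) : Prop :=
  IsRSSeed (q (-1)) (q 0) ∧ rsSubstWord (rsSubstWord q) = q

/-- The bi-infinite word that grows out of the seed `l | r`. -/
def rsGrow (l r : Fin 4) (i : ℤ) : Fin 4 :=
  if i = 0 then r else if i = -1 then l else
    let a := rsSubst (rsGrow l r (i / 2 / 2)) (if Even (i / 2) then 0 else 1)
    rsSubst a (if Even i then 0 else 1)
termination_by i.natAbs
decreasing_by omega

/-- Every legal seed does give a bi-infinite fixed point. -/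
theorem exists_isRSFixedPoint (l r : Fin 4) (h : IsRSSeed l r) :
    ∃ q, IsRSFixedPoint q ∧ q (-1) = l ∧ q 0 = r := by
  have h0 : rsGrow l r 0 = r := by rw [rsGrow]; simp
  have h1 : rsGrow l r (-1) = l := by rw [rsGrow]; simp
  refine ⟨rsGrow l r, ⟨by rw [h0, h1]; exact h, ?_⟩, h1, h0⟩
  funext i
  by_cases hi : i = 0
  · subst hi
    obtain ⟨-, rfl | rfl⟩ := h <;> simp [rsSubstWord, h0, rsSubst]
  by_cases hi' : i = -1
  · subst hi'
    have e : (-1 : ℤ) / 2 = -1 := by decide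
    have e' : ¬ Even (-1 : ℤ) := by decide
    obtain ⟨rfl | rfl, -⟩ := h <;> simp [rsSubstWord, e, h1, rsSubst]
  · conv_rhs => rw [rsGrow]
    by_cases ha : Even i <;> by_cases hb : Even (i / 2) <;> simp [rsSubstWord, hi, hi', ha, hb]

/-- The coding `φ(0) = φ(2) = 1`, `φ(1) = φ(3) = -1`; the alphabet `{±1}` is `ℤˣ`. -/
def rsCoding : Fin 4 → ℤˣ := ![1, -1, 1, -1]

/-- The binary Rudin--Shapiro word over `{±1}` that belongs to a quaternary word. -/
def rsBinary (q : ℤ → Fin 4) : ℤ → ℤˣ := fun i => rsCoding (q i)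

/-! ### The hull and its invariant measure -/

/-- Translation of bi-infinite words by `t`. -/
def wordShift (t : ℤ) (x : ℤ → ℤˣ) : ℤ → ℤˣ := fun i => x (i + t)

/-- The hull of a bi-infinite word: the closure of its translation orbit in the product
topology. -/
def wordHull (w : ℤ → ℤˣ) : Set (ℤ → ℤˣ) := closure (Set.range fun t : ℤ => wordShift t w)

/-- `μ` is a shift-invariant probability measure on the hull of `w`. -/
def IsHullMeasure (w : ℤ → ℤˣ) (μ : Measure (ℤ → ℤˣ)) : Prop :=
  IsProbabilityMeasure μ ∧ μ (wordHull w)ᶜ = 0 ∧ MeasurePreserving (wordShift 1) μ μ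

/-! ### Correlation functions

The `n`-point functions have the arguments `m = (m₁, …, mₙ₋₁)`, given as `m : Fin (n - 1) → ℤ`. -/

/-- The positions `(0, m₁, …, mₙ₋₁)`. -/
def corrPos {n : ℕ} (m : Fin (n - 1) → ℤ) : Fin n → ℤ :=
  fun k => if h : k.val = 0 then 0 else m ⟨k.val - 1, by omega⟩

/-- The average `(2N+1)⁻¹ ∑_{i=-N}^{N} wᵢ wᵢ₊ₘ₁ ⋯` over the window `[-N, N]`. -/
noncomputable def etaAvg (w : ℤ → ℤˣ) (n : ℕ) (m : Fin (n - 1) → ℤ) (N : ℕ) : ℝ :=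
  1 / (2 * (N : ℝ) + 1) *
    ∑ i ∈ Finset.Icc (-(N : ℤ)) (N : ℤ), ∏ k : Fin n, (((w (i + corrPos m k) : ℤˣ) : ℤ) : ℝ)

/-- The signed average `(2N+1)⁻¹ ∑_{i=-N}^{N} (-1)ⁱ wᵢ wᵢ₊ₘ₁ ⋯`. -/
noncomputable def thetaAvg (w : ℤ → ℤˣ) (n : ℕ) (m : Fin (n - 1) → ℤ) (N : ℕ) : ℝ :=
  1 / (2 * (N : ℝ) + 1) *
    ∑ i ∈ Finset.Icc (-(N : ℤ)) (N : ℤ),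
      (-1 : ℝ) ^ i * ∏ k : Fin n, (((w (i + corrPos m k) : ℤˣ) : ℤ) : ℝ)

/-- The balanced `n`-point correlation function `η⁽ⁿ⁾` of the word `w`. -/
noncomputable def etaCorr (w : ℤ → ℤˣ) (n : ℕ) (m : Fin (n - 1) → ℤ) : ℝ :=
  limUnder atTop (etaAvg w n m)

/-- The signed `n`-point correlation function `θ⁽ⁿ⁾` of the word `w`. -/
noncomputable def thetaCorr (w : ℤ → ℤˣ) (n : ℕ) (m : Fin (n - 1) → ℤ) : ℝ :=
  limUnder atTop (thetaAvg w n m)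

/-- The `n`-point correlation function with weight `f`,
`∫ f(x₀) f(x_{m₁}) ⋯ f(x_{mₙ₋₁}) dμ(x)`. -/
noncomputable def weightedCorr (μ : Measure (ℤ → ℤˣ)) (f : ℤˣ → ℝ) (n : ℕ)
    (m : Fin (n - 1) → ℤ) : ℝ :=
  ∫ x, ∏ k : Fin n, f (x (corrPos m k)) ∂μ

/-! ### From balanced to weighted correlations -/

/-- `E(f) = (f(1) + f(-1)) / 2`. -/
noncomputable def weightMean (f : ℤˣ → ℝ) : ℝ := (f 1 + f (-1)) / 2

/-- `h_f = (f(1) - f(-1)) / 2`. -/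
noncomputable def weightDiff (f : ℤˣ → ℝ) : ℝ := (f 1 - f (-1)) / 2

/-- The relative positions `(p₁ - p₀, …, pₖ₋₁ - p₀)`. -/
def relPos {k : ℕ} (p : Fin k → ℤ) : Fin (k - 1) → ℤ :=
  fun j => p ⟨j.val + 1, by have := j.isLt; omega⟩ - p ⟨0, by have := j.isLt; omega⟩

/-- For a family `G` of `k`-point functions, the bracket
`⟨p₀, …, pₖ₋₁⟩ = G⁽ᵏ⁾(p₁ - p₀, …, pₖ₋₁ - p₀)` for `k ≥ 2`; the empty bracket is `1`, and the
bracket of one point is `0`. -/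
noncomputable def corrBracket (G : ∀ k : ℕ, (Fin (k - 1) → ℤ) → ℝ) {k : ℕ} (p : Fin k → ℤ) : ℝ :=
  if k = 0 then 1 else if k = 1 then 0 else G k (relPos p)

/-- The value at `m` of the weighted `n`-point function that is computed from a family `G` of
`k`-point functions, `2 ≤ k ≤ n`: the sum over all sets `S` of positions of
`E(f)^(n - |S|) * h_f^|S| * ⟨m_s : s ∈ S⟩`. -/
noncomputable def weightedFrom (G : ∀ k : ℕ, (Fin (k - 1) → ℤ) → ℝ) (f : ℤˣ → ℝ) (n : ℕ)
    (m : Fin (n - 1) → ℤ) : ℝ :=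
  ∑ S : Finset (Fin n), weightMean f ^ (n - S.card) * weightDiff f ^ S.card *
    corrBracket G (fun j : Fin S.card => corrPos m (S.orderEmbOfFin rfl j))

/-! ### Renormalisation equations

The letters satisfy `w a = rsSign a * w (a / 4)`. Substituting this in the sums over `i = 4 i' + j`
gives the renormalisation equations below. -/

/-- The sign `1` if `a ≡ 0, 1 (mod 4)`, and `(-1)^(c + ℓ)` if `a = 4 c + ℓ` with `ℓ ∈ {2, 3}`. -/
noncomputable def rsSign (a : ℤ) : ℝ :=
  if a % 4 = 0 ∨ a % 4 = 1 then 1 else (-1) ^ (a / 4 + a % 4)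

/-- The product of the signs at the positions `j, m₁ + j, …, mₙ₋₁ + j`. -/
noncomputable def renormSign {n : ℕ} (m : Fin (n - 1) → ℤ) (j : ℕ) : ℝ :=
  ∏ k : Fin n, rsSign (corrPos m k + j)

/-- How many of the positions `j, m₁ + j, …, mₙ₋₁ + j` are `≡ 2, 3 (mod 4)`. -/
def renormTwist {n : ℕ} (m : Fin (n - 1) → ℤ) (j : ℕ) : ℕ :=
  (Finset.univ.filter fun k : Fin n => 2 ≤ (corrPos m k + j) % 4).card

/-- The new arguments `⌊(mₖ + j) / 4⌋`. -/
def renormArg {n : ℕ} (m : Fin (n - 1) → ℤ) (j : ℕ) : Fin (n - 1) → ℤ :=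
  fun k => (m k + j) / 4

/-- The pair `(G, H)` solves the renormalisation equations of the `n`-point functions
`(η⁽ⁿ⁾, θ⁽ⁿ⁾)`. -/
def IsRenormSolution (n : ℕ) (G H : (Fin (n - 1) → ℤ) → ℝ) : Prop :=
  ∀ m : Fin (n - 1) → ℤ,
    G m = 1 / 4 * ∑ j ∈ Finset.range 4, renormSign m j *
      (if Even (renormTwist m j) then G (renormArg m j) else H (renormArg m j)) ∧
    H m = 1 / 4 * ∑ j ∈ Finset.range 4, (-1) ^ j * (renormSign m j *
      (if Even (renormTwist m j) then G (renormArg m j) else H (renormArg m j)))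

/-- The family `(G⁽ᵏ⁾, H⁽ᵏ⁾)`, `2 ≤ k ≤ n`, solves the renormalisation equations and has the
cancellation property at the origin. -/
def IsRenormFamily (n : ℕ) (G H : ∀ k : ℕ, (Fin (k - 1) → ℤ) → ℝ) : Prop :=
  (∀ k, 2 ≤ k → k ≤ n → IsRenormSolution k (G k) (H k)) ∧
  (∀ k, 2 ≤ k → k + 2 ≤ n → G (k + 2) (fun _ => 0) = G k (fun _ => 0))

/-!
The binary word satisfies `w a = ± w (a / 4)`, with the explicit sign `rsSign a`. So a monomial
`(-1)^(σ i) ∏ w (i + pₖ)`, restricted to the positions `4 i + j`, is up to a sign again such a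
monomial (`IsRSSequence.rsMonomial_four_mul`), and its positions `(pₖ + j) / 4` span a window of
about a quarter of the length. A sequence has a uniform mean if its restrictions to the four
classes mod `4` have one (`hasUniformMean_of_block`), so by induction on the window it is enough to
treat the monomials in the positions `0, 1`. For these the block sums reproduce the sequence with a
factor of at most `2`, up to a sequence of mean zero, whereas blocks are four times as long; hence
their means vanish (`hasUniformMean_zero_of_blockSum_eq`), apart from the trivial monomial `1`.
This gives the existence of all correlations, and comparing the means on both sides of the block
decomposition gives the renormalisation equations (`IsRSSequence.rsMean_renorm`).

The means are uniform in the position of the averaging interval, so the estimates for `w` pass to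
its translates and, by continuity, to the hull. Every invariant probability measure on the hull
therefore gives each character `x ↦ ∏ x (pₖ)` its mean along `w` as integral
(`IsHullMeasure.integral_wordChar`). The characters span the indicators of cylinders, so the measure
is unique; it exists as an accumulation point of empirical measures, by compactness of the space of
probability measures (`existsUnique_isHullMeasure`). The weighted correlations follow by writing
`f u = h_f * u + E(f)` for `u = ±1` and expanding the product (`IsRSFixedPoint.weightedCorr_eq`).

For the uniqueness of renormalisation families, the equations are followed from an argument `m`:
after finitely many steps all entries lie in `{0, 1}` or in `{-1, 0}`, where three of the four terms
are values at the origin and the last one reproduces the argument with the factor `1 / 4`. So a solution that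
vanishes at the origin is zero (`IsRenormSolution.eq_zero`). At the origin the equations force
`H 0 = 0`, and `G 0 = 0` for odd orders (`IsRenormSolution.origin`), while all even orders share one
value, which is the only freedom (`IsRenormFamily.eq_of_origin`).
-/

/-! ### Uniform means of sequences -/

/-- The averages of `g` over long intervals, wherever these lie, are within `δ` of `c`, up to
bounded boundary terms. -/
def HasUniformMeanUpTo (g : ℤ → ℝ) (c δ : ℝ) : Prop :=
  ∃ C : ℝ, ∀ (a : ℤ) (L : ℕ), |∑ i ∈ Finset.range L, g (a + i) - c * L| ≤ δ * L + C

/-- `c` is the mean of `g`, uniformly in the position of the averaging interval. -/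
def HasUniformMean (g : ℤ → ℝ) (c : ℝ) : Prop := ∀ δ : ℝ, 0 < δ → HasUniformMeanUpTo g c δ

theorem HasUniformMeanUpTo.add {g h : ℤ → ℝ} {c d δ ε : ℝ} (hg : HasUniformMeanUpTo g c δ)
    (hh : HasUniformMeanUpTo h d ε) : HasUniformMeanUpTo (fun i => g i + h i) (c + d) (δ + ε) := by
  obtain ⟨C, hC⟩ := hg
  obtain ⟨D, hD⟩ := hh
  refine ⟨C + D, fun a L => ?_⟩
  rw [Finset.sum_add_distrib]
  have h1 := abs_le.1 (hC a L)
  have h2 := abs_le.1 (hD a L)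
  rw [abs_le]
  constructor <;> linarith

theorem HasUniformMeanUpTo.const_mul {g : ℤ → ℝ} {c δ : ℝ} (k : ℝ)
    (hg : HasUniformMeanUpTo g c δ) :
    HasUniformMeanUpTo (fun i => k * g i) (k * c) (|k| * δ) := by
  obtain ⟨C, hC⟩ := hg
  refine ⟨|k| * C, fun a L => ?_⟩
  rw [← Finset.mul_sum, mul_assoc k c, ← mul_sub, abs_mul, mul_assoc, ← mul_add]
  exact mul_le_mul_of_nonneg_left (hC a L) (abs_nonneg k)

theorem HasUniformMean.add {g h : ℤ → ℝ} {c d : ℝ} (hg : HasUniformMean g c)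
    (hh : HasUniformMean h d) : HasUniformMean (fun i => g i + h i) (c + d) := fun δ hδ => by
  simpa using (hg (δ / 2) (half_pos hδ)).add (hh (δ / 2) (half_pos hδ))

theorem HasUniformMean.const_mul {g : ℤ → ℝ} {c : ℝ} (k : ℝ) (hg : HasUniformMean g c) :
    HasUniformMean (fun i => k * g i) (k * c) := fun δ hδ => by
  obtain ⟨C, hC⟩ := (hg (δ / (|k| + 1)) (by positivity)).const_mul k
  refine ⟨C, fun a L => (hC a L).trans ?_⟩
  have : |k| * (δ / (|k| + 1)) ≤ δ := by
    rw [mul_div_assoc', div_le_iff₀ (by positivity)]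
    nlinarith [abs_nonneg k]
  gcongr

theorem hasUniformMean_const (c : ℝ) : HasUniformMean (fun _ => c) c := fun δ hδ =>
  ⟨0, fun a L => by simp [mul_comm]; positivity⟩

theorem HasUniformMean.translate {g : ℤ → ℝ} {c : ℝ} (hg : HasUniformMean g c) (t : ℤ) :
    HasUniformMean (fun i => g (i + t)) c := fun δ hδ => by
  obtain ⟨C, hC⟩ := hg δ hδ
  refine ⟨C, fun a L => ?_⟩
  simpa only [add_right_comm] using hC (a + t) L

theorem abs_sum_range_le {g : ℤ → ℝ} {B : ℝ} (hB : ∀ i, |g i| ≤ B) (a : ℤ) (L : ℕ) :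
    |∑ i ∈ Finset.range L, g (a + i)| ≤ B * L :=
  (Finset.abs_sum_le_sum_abs _ _).trans <|
    (Finset.sum_le_sum fun _ _ => hB _).trans (by simp [mul_comm])

/-- The sum of `g` over the `i`-th block of four consecutive positions. -/
def blockSum (g : ℤ → ℝ) (i : ℤ) : ℝ := g (4 * i) + g (4 * i + 1) + g (4 * i + 2) + g (4 * i + 3)

theorem sum_range_blockSum (g : ℤ → ℝ) (b : ℤ) (K : ℕ) :
    ∑ i ∈ Finset.range (4 * K), g (4 * b + i) = ∑ i ∈ Finset.range K, blockSum g (b + i) := by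
  induction K with
  | zero => simp
  | succ K ih =>
    rw [Finset.sum_range_succ, ← ih, show 4 * (K + 1) = 4 * K + 1 + 1 + 1 + 1 by ring]
    simp only [Finset.sum_range_succ, blockSum]
    push_cast
    ring_nf

/-- A mean of the block sums gives a mean of the sequence. -/
theorem HasUniformMeanUpTo.of_blockSum {g : ℤ → ℝ} {B c δ : ℝ} (hB : ∀ i, |g i| ≤ B)
    (hδ : 0 ≤ δ) (h : HasUniformMeanUpTo (blockSum g) c δ) :
    HasUniformMeanUpTo g (c / 4) (δ / 4) := by
  obtain ⟨C, hC⟩ := h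
  refine ⟨C + δ + 6 * B + |c|, fun a L => ?_⟩
  have hB0 : 0 ≤ B := (abs_nonneg _).trans (hB 0)
  -- The interval is extended to the left by `r` positions to the start of a block; then `K` full
  -- blocks and `s` further positions fit into it.
  obtain ⟨b, r, hr, rfl⟩ : ∃ (b : ℤ) (r : ℕ), r ≤ 3 ∧ a = 4 * b + r :=
    ⟨a / 4, (a % 4).toNat, by omega, by omega⟩
  obtain ⟨K, s, hs, hK⟩ : ∃ K s : ℕ, s ≤ 3 ∧ r + L = 4 * K + s :=
    ⟨(r + L) / 4, (r + L) % 4, by omega, by omega⟩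
  have e1 : ∑ i ∈ Finset.range (r + L), g (4 * b + i) =
      ∑ i ∈ Finset.range r, g (4 * b + i) + ∑ i ∈ Finset.range L, g (4 * b + r + i) := by
    rw [Finset.sum_range_add]; push_cast; simp only [add_assoc]
  have e2 : ∑ i ∈ Finset.range (r + L), g (4 * b + i) =
      ∑ i ∈ Finset.range K, blockSum g (b + i) +
        ∑ i ∈ Finset.range s, g (4 * b + (4 * K : ℕ) + i) := by
    rw [hK, Finset.sum_range_add, sum_range_blockSum]; push_cast; simp only [add_assoc]
  have hr' : (r : ℝ) ≤ 3 := by exact_mod_cast hr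
  have hs' : (s : ℝ) ≤ 3 := by exact_mod_cast hs
  have hr0 : (0 : ℝ) ≤ r := by positivity
  have hs0 : (0 : ℝ) ≤ s := by positivity
  have hK' : (K : ℝ) = (r + L - s) / 4 := by
    have : (r : ℝ) + L = 4 * K + s := by exact_mod_cast hK
    linarith
  have b1 := abs_le.1 ((abs_sum_range_le hB (4 * b) r).trans
    (mul_le_mul_of_nonneg_left hr' hB0))
  have b2 := abs_le.1 ((abs_sum_range_le hB (4 * b + (4 * K : ℕ)) s).trans
    (mul_le_mul_of_nonneg_left hs' hB0))
  have b3 := abs_le.1 (hC b K)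
  have b4 : |c * (r - s)| ≤ |c| * 3 := by
    rw [abs_mul]
    exact mul_le_mul_of_nonneg_left (abs_le.2 ⟨by linarith, by linarith⟩) (abs_nonneg c)
  have b4 := abs_le.1 b4
  have b5 : δ * (r - s) ≤ δ * 3 := mul_le_mul_of_nonneg_left (by linarith) hδ
  rw [hK'] at b3
  have c0 := abs_nonneg c
  rw [abs_le]
  constructor <;> linarith

theorem hasUniformMean_of_block {g : ℤ → ℝ} {B : ℝ} (hB : ∀ i, |g i| ≤ B) {c : ℕ → ℝ}
    (h : ∀ j : ℕ, j < 4 → HasUniformMean (fun i => g (4 * i + j)) (c j)) :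
    HasUniformMean g (1 / 4 * ∑ j ∈ Finset.range 4, c j) := by
  have key : HasUniformMean (blockSum g) (c 0 + c 1 + c 2 + c 3) := by
    have := (((h 0 (by norm_num)).add (h 1 (by norm_num))).add (h 2 (by norm_num))).add
      (h 3 (by norm_num))
    simp only [Nat.cast_zero, add_zero, Nat.cast_one, Nat.cast_ofNat] at this
    exact this
  intro δ hδ
  have := HasUniformMeanUpTo.of_blockSum hB (by positivity) (key (4 * δ) (by positivity))
  convert this using 1
  · simp [Finset.sum_range_succ]; ring
  · ring

/-- If passing from `g` to its block sums reproduces at most `2 * g` up to a sequence of mean `0`,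
then `g` has mean `0`: each passage to blocks divides the lengths of intervals by `4`, so it
reduces the possible deviation of the averages from `0` by a factor. -/
theorem hasUniformMean_zero_of_blockSum_eq {g h : ℤ → ℝ} {B u : ℝ} (hB : ∀ i, |g i| ≤ B)
    (hu : |u| ≤ 2) (hh : HasUniformMean h 0) (e : ∀ i, blockSum g i = u * g i + h i) :
    HasUniformMean g 0 := by
  have hB0 : 0 ≤ B := (abs_nonneg _).trans (hB 0)
  have step : ∀ k : ℕ, HasUniformMeanUpTo g 0 ((3 / 4) ^ k * (B + 1)) := by
    intro k
    induction k with
    | zero =>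
      refine ⟨0, fun a L => ?_⟩
      have := abs_sum_range_le hB a L
      have hL : (0 : ℝ) ≤ L := by positivity
      simp only [zero_mul, sub_zero, pow_zero]
      linarith
    | succ k ih =>
      set δ := (3 / 4 : ℝ) ^ k * (B + 1) with hδ
      have δ0 : 0 < δ := by positivity
      have h1 := (ih.const_mul u).add (hh δ δ0)
      rw [← funext e] at h1
      obtain ⟨C, hC⟩ := h1.of_blockSum hB (by positivity)
      refine ⟨C, fun a L => ?_⟩
      have h2 := hC a L
      have h3 : |u| * δ ≤ 2 * δ := by gcongr
      simp only [mul_zero, add_zero, zero_div] at h2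
      refine h2.trans ?_
      have : (|u| * δ + δ) / 4 ≤ (3 / 4) ^ (k + 1) * (B + 1) := by
        rw [pow_succ]; linarith
      gcongr
  intro δ hδ
  obtain ⟨k, hk⟩ := exists_pow_lt_of_lt_one (show 0 < δ / (B + 1) by positivity)
    (show (3 / 4 : ℝ) < 1 by norm_num)
  obtain ⟨C, hC⟩ := step k
  refine ⟨C, fun a L => (hC a L).trans ?_⟩
  have : (3 / 4 : ℝ) ^ k * (B + 1) ≤ δ := by
    rw [lt_div_iff₀ (by positivity)] at hk
    exact hk.le
  gcongr

theorem eventually_le_mul_natCast {C δ : ℝ} (hδ : 0 < δ) :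
    ∀ᶠ L : ℕ in atTop, C ≤ δ * L := by
  filter_upwards [tendsto_natCast_atTop_atTop.eventually_ge_atTop (C / δ)] with L hL
  rwa [div_le_iff₀' hδ] at hL

theorem HasUniformMean.eventually_abs_sum_le {g : ℤ → ℝ} {c : ℝ} (h : HasUniformMean g c)
    {δ : ℝ} (hδ : 0 < δ) :
    ∀ᶠ L : ℕ in atTop, ∀ a : ℤ, |∑ i ∈ Finset.range L, g (a + i) - c * L| ≤ δ * L := by
  obtain ⟨C, hC⟩ := h (δ / 2) (half_pos hδ)
  filter_upwards [eventually_le_mul_natCast (C := C) (half_pos hδ)] with L hL a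
  have := hC a L
  linarith

/-- A uniform mean is the limit of the averages over the windows `[-N, N]`. -/
theorem HasUniformMean.tendsto_avg {g : ℤ → ℝ} {c : ℝ} (h : HasUniformMean g c) :
    Tendsto (fun N : ℕ => 1 / (2 * (N : ℝ) + 1) *
      ∑ i ∈ Finset.Icc (-(N : ℤ)) (N : ℤ), g i) atTop (𝓝 c) := by
  rw [Metric.tendsto_atTop]
  intro ε hε
  obtain ⟨L₀, hL₀⟩ := eventually_atTop.1 (h.eventually_abs_sum_le (half_pos hε))
  refine ⟨L₀, fun N hN => ?_⟩
  have h1 := hL₀ (2 * N + 1) (by omega) (-(N : ℤ))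
  have e : ∑ i ∈ Finset.Icc (-(N : ℤ)) (N : ℤ), g i =
      ∑ i ∈ Finset.range (2 * N + 1), g (-(N : ℤ) + i) := by
    symm
    refine Finset.sum_bij (fun i _ => -(N : ℤ) + i) ?_ ?_ ?_ ?_
    · intro i hi; simp at hi ⊢; omega
    · intro i _ j _ hij; simpa using hij
    · intro b hb
      simp only [Finset.mem_Icc] at hb
      exact ⟨(b + N).toNat, by simp; omega, by omega⟩
    · intros; rfl
  have hpos : (0 : ℝ) < 2 * N + 1 := by positivity
  push_cast at h1
  rw [e, Real.dist_eq]
  have : 1 / (2 * (N : ℝ) + 1) * ∑ i ∈ Finset.range (2 * N + 1), g (-(N : ℤ) + i) - c =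
      (∑ i ∈ Finset.range (2 * N + 1), g (-(N : ℤ) + i) - c * (2 * N + 1)) / (2 * N + 1) := by
    field_simp
  rw [this, abs_div, abs_of_pos hpos, div_lt_iff₀ hpos]
  nlinarith

theorem HasUniformMean.unique {g : ℤ → ℝ} {c d : ℝ} (hc : HasUniformMean g c)
    (hd : HasUniformMean g d) : c = d :=
  tendsto_nhds_unique hc.tendsto_avg hd.tendsto_avg

/-! ### The letters of the binary word -/

/-- In a fixed point, the letters at even positions are `0` or `3`, those at odd positions are
`1` or `2`. -/
theorem IsRSFixedPoint.letter_parity {q : ℤ → Fin 4} (hq : IsRSFixedPoint q) (c : ℤ) :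
    (Even c → q c = 0 ∨ q c = 3) ∧ (¬ Even c → q c = 1 ∨ q c = 2) := by
  have key : ∀ a : Fin 4, (rsSubst a 0 = 0 ∨ rsSubst a 0 = 3) ∧
      (rsSubst a 1 = 1 ∨ rsSubst a 1 = 2) := by decide
  rw [← hq.2]
  constructor <;> intro hc <;> simp only [rsSubstWord, hc, if_true, if_false]
  exacts [(key _).1, (key _).2]

theorem neg_one_zpow_four_mul_add (i : ℤ) (j : ℕ) :
    (-1 : ℝ) ^ (4 * i + j) = (-1) ^ j := by
  rw [zpow_add₀ (by norm_num), zpow_mul]; norm_num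

theorem rsSign_four_mul_add (i b : ℤ) :
    rsSign (4 * i + b) = rsSign b * (if 2 ≤ b % 4 then (-1) ^ i else 1) := by
  have h1 : (4 * i + b) % 4 = b % 4 := by omega
  have h2 : (4 * i + b) / 4 = i + b / 4 := by omega
  unfold rsSign
  rw [h1, h2]
  by_cases h : b % 4 = 0 ∨ b % 4 = 1
  · rw [if_pos h, if_pos h, if_neg (by omega)]; simp
  · rw [if_neg h, if_neg h, if_pos (by omega), add_assoc, zpow_add₀ (by norm_num), mul_comm]

/-- The binary word of a quaternary word, with real letters. -/
noncomputable def rsReal (q : ℤ → Fin 4) (i : ℤ) : ℝ := ((rsBinary q i : ℤ) : ℝ)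

/-- A sequence of signs with `W a = rsSign a * W (a / 4)`. Of the binary word, only this property is
used for the correlations. -/
structure IsRSSequence (W : ℤ → ℝ) : Prop where
  sq_eq_one : ∀ i, W i ^ 2 = 1
  renorm : ∀ a, W a = rsSign a * W (a / 4)

theorem unit_cast_sq (u : ℤˣ) : (((u : ℤ) : ℝ)) ^ 2 = 1 := by
  rcases Int.units_eq_one_or u with rfl | rfl <;> simp

/-- The coded image of a letter `a` under the square of the substitution: `φ(a)` twice, then
`φ(a), -φ(a)` for the letters `0, 3` of even positions, and `-φ(a), φ(a)` for the others. -/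
theorem rsCoding_rsSubst_rsSubst (a : Fin 4) (x y : Fin 2) :
    rsCoding (rsSubst (rsSubst a x) y) = if x = 0 then rsCoding a else
      if (a = 0 ∨ a = 3 ↔ y = 0) then rsCoding a else -rsCoding a := by
  revert a x y; decide

theorem IsRSFixedPoint.isRSSequence {q : ℤ → Fin 4} (hq : IsRSFixedPoint q) :
    IsRSSequence (rsReal q) := by
  refine ⟨fun i => unit_cast_sq _, fun a => ?_⟩
  obtain ⟨c, l, rfl, hl⟩ : ∃ c l : ℤ, a = 4 * c + l ∧ (l = 0 ∨ l = 1 ∨ l = 2 ∨ l = 3) :=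
    ⟨a / 4, a % 4, by omega, by omega⟩
  have hc : (4 * c + l) / 4 = c := by omega
  have h2 : q (4 * c + l) = rsSubst (rsSubst (q c) (if Even ((4 * c + l) / 2) then 0 else 1))
      (if Even (4 * c + l) then 0 else 1) := by
    conv_lhs => rw [← hq.2]
    have e : (4 * c + l) / 2 / 2 = c := by omega
    simp only [rsSubstWord, e]
    split_ifs <;> rfl
  have hx : Even ((4 * c + l) / 2) ↔ l = 0 ∨ l = 1 := by rw [Int.even_iff]; omega
  have hy : Even (4 * c + l) ↔ l = 0 ∨ l = 2 := by rw [Int.even_iff]; omega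
  have hev : (q c = 0 ∨ q c = 3) ↔ Even c := by
    refine ⟨fun h => ?_, (hq.letter_parity c).1⟩
    by_contra hc
    rcases (hq.letter_parity c).2 hc with h' | h' <;> rw [h'] at h <;> revert h <;> decide
  have hpow : (-1 : ℝ) ^ c = if Even c then 1 else -1 := by
    split_ifs with h
    exacts [h.neg_one_zpow, (Int.not_even_iff_odd.1 h).neg_one_zpow]
  rw [rsSign_four_mul_add, hc]
  simp only [rsReal, rsBinary, h2, rsCoding_rsSubst_rsSubst, hx, hy, hev, hpow]
  rcases hl with rfl | rfl | rfl | rfl <;> by_cases h : Even c <;> norm_num [h, rsSign]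

theorem IsRSSequence.abs_eq_one {W : ℤ → ℝ} (hW : IsRSSequence W) (i : ℤ) : |W i| = 1 := by
  rw [← sq_eq_sq₀ (abs_nonneg _) zero_le_one, sq_abs, hW.sq_eq_one, one_pow]

theorem IsRSSequence.four_mul {W : ℤ → ℝ} (hW : IsRSSequence W) (i : ℤ) (j : ℤ) :
    W (4 * i + j) = rsSign j * (if 2 ≤ j % 4 then (-1) ^ i else 1) * W (i + j / 4) := by
  rw [hW.renorm, rsSign_four_mul_add]
  congr 2
  omega

/-! ### Monomials in the letters -/

/-- The monomial `(-1)^(σ i) ∏_{k ∈ S} W (i + p k)`. -/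
noncomputable def rsMonomial (W : ℤ → ℝ) {ι : Type} (S : Finset ι) (p : ι → ℤ) (σ : ℕ) (i : ℤ) :
    ℝ :=
  ((-1 : ℝ) ^ i) ^ σ * ∏ k ∈ S, W (i + p k)

theorem IsRSSequence.abs_rsMonomial_le {W : ℤ → ℝ} (hW : IsRSSequence W) {ι : Type}
    (S : Finset ι) (p : ι → ℤ) (σ : ℕ) (i : ℤ) : |rsMonomial W S p σ i| ≤ 1 := by
  simp [rsMonomial, abs_mul, Finset.abs_prod, hW.abs_eq_one, abs_zpow]

theorem rsMonomial_add (W : ℤ → ℝ) {ι : Type} (S : Finset ι) (p : ι → ℤ) (σ : ℕ) (t i : ℤ) :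
    rsMonomial W S p σ (i + t) = ((-1 : ℝ) ^ t) ^ σ * rsMonomial W S (fun k => p k + t) σ i := by
  simp only [rsMonomial, zpow_add₀ (show (-1 : ℝ) ≠ 0 by norm_num), mul_pow]
  simp only [add_assoc, add_comm t]
  ring

theorem neg_one_zpow_sq (i : ℤ) : ((-1 : ℝ) ^ i) ^ 2 = 1 := by
  rw [← zpow_natCast, ← zpow_mul, mul_comm, zpow_mul]; norm_num

theorem pow_eq_ite_of_sq_eq_one {x : ℝ} (hx : x ^ 2 = 1) (n : ℕ) :
    x ^ n = if Even n then 1 else x := by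
  split_ifs with h
  · obtain ⟨k, rfl⟩ := h
    rw [← two_mul, pow_mul, hx, one_pow]
  · obtain ⟨k, rfl⟩ := Nat.not_even_iff_odd.1 h
    rw [pow_succ, pow_mul, hx, one_pow, one_mul]

theorem rsMonomial_congr_parity (W : ℤ → ℝ) {ι : Type} (S : Finset ι) (p : ι → ℤ) (σ : ℕ) :
    rsMonomial W S p σ = rsMonomial W S p (if Even σ then 0 else 1) := by
  funext i
  simp only [rsMonomial]
  rw [pow_eq_ite_of_sq_eq_one (neg_one_zpow_sq i)]
  split_ifs <;> simp

/-- Along the positions `4 i + j`, a monomial is, up to a sign, another monomial whose positions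
span a window of about a quarter of the length. -/
theorem IsRSSequence.rsMonomial_four_mul {W : ℤ → ℝ} (hW : IsRSSequence W) {ι : Type}
    (S : Finset ι) (p : ι → ℤ) (σ : ℕ) (i : ℤ) (j : ℕ) :
    rsMonomial W S p σ (4 * i + j) = ((-1) ^ j) ^ σ * (∏ k ∈ S, rsSign (p k + j)) *
      rsMonomial W S (fun k => (p k + j) / 4)
        (S.filter fun k => 2 ≤ (p k + j) % 4).card i := by
  have e : ∀ k, W (4 * i + j + p k) = rsSign (p k + j) *
      (if 2 ≤ (p k + j) % 4 then (-1) ^ i else 1) * W (i + (p k + j) / 4) := fun k => by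
    rw [← hW.four_mul]
    congr 1
    ring
  simp only [rsMonomial, neg_one_zpow_four_mul_add, e, Finset.prod_mul_distrib]
  rw [Finset.prod_ite]
  simp only [Finset.prod_const, one_pow, mul_one]
  ring

/-! ### Means of monomials -/

section Window

variable {W : ℤ → ℝ}

theorem neg_one_zpow_block (i : ℤ) :
    (-1 : ℝ) ^ (4 * i) = 1 ∧ (-1 : ℝ) ^ (4 * i + 1) = -1 ∧ (-1 : ℝ) ^ (4 * i + 2) = 1 ∧
      (-1 : ℝ) ^ (4 * i + 3) = -1 := by
  have := neg_one_zpow_four_mul_add i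
  have h0 := this 0
  have h1 := this 1
  have h2 := this 2
  have h3 := this 3
  push_cast at h0 h1 h2 h3
  simp only [add_zero] at h0
  rw [h0, h1, h2, h3]
  norm_num

theorem hasUniformMean_neg_one_zpow : HasUniformMean (fun i : ℤ => (-1 : ℝ) ^ i) 0 := by
  refine hasUniformMean_zero_of_blockSum_eq (h := fun _ => 0) (u := 0) (B := 1) (fun i => ?_)
    (by simp) (hasUniformMean_const 0) fun i => ?_
  · simp [abs_zpow]
  · obtain ⟨s0, s1, s2, s3⟩ := neg_one_zpow_block i
    rw [blockSum, s0, s1, s2, s3]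
    norm_num

theorem IsRSSequence.letter_block (hW : IsRSSequence W) (i : ℤ) :
    W (4 * i) = W i ∧ W (4 * i + 1) = W i ∧ W (4 * i + 2) = (-1) ^ i * W i ∧
      W (4 * i + 3) = -((-1) ^ i * W i) ∧ W (4 * i + 3 + 1) = W (i + 1) := by
  have h0 := hW.four_mul i 0
  have h4 := hW.four_mul i 4
  rw [add_zero] at h0
  refine ⟨?_, ?_, ?_, ?_, ?_⟩
  · rw [h0]; norm_num [rsSign]
  · rw [hW.four_mul]; norm_num [rsSign]
  · rw [hW.four_mul]; norm_num [rsSign]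
  · rw [hW.four_mul]; norm_num [rsSign]
  · rw [show 4 * i + 3 + 1 = 4 * i + 4 by ring, h4]; norm_num [rsSign]

theorem IsRSSequence.hasUniformMean_letter (hW : IsRSSequence W) : HasUniformMean W 0 := by
  refine hasUniformMean_zero_of_blockSum_eq (h := fun _ => 0) (u := 2)
    (fun i => (hW.abs_eq_one i).le) (by norm_num) (hasUniformMean_const 0) fun i => ?_
  obtain ⟨h0, h1, h2, h3, -⟩ := hW.letter_block i
  rw [blockSum, h0, h1, h2, h3]
  ring

theorem IsRSSequence.hasUniformMean_signed_letter (hW : IsRSSequence W) :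
    HasUniformMean (fun i => (-1) ^ i * W i) 0 := by
  refine hasUniformMean_zero_of_blockSum_eq (h := fun _ => 0) (u := 2) (B := 1)
    (fun i => by simp [abs_mul, abs_zpow, hW.abs_eq_one]) (by norm_num)
    (hasUniformMean_const 0) fun i => ?_
  obtain ⟨h0, h1, h2, h3, -⟩ := hW.letter_block i
  obtain ⟨s0, s1, s2, s3⟩ := neg_one_zpow_block i
  rw [blockSum, h0, h1, h2, h3, s0, s1, s2, s3]
  ring

theorem IsRSSequence.hasUniformMean_signed_pair (hW : IsRSSequence W) :
    HasUniformMean (fun i => (-1) ^ i * (W i * W (i + 1))) 0 := by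
  have hs := hasUniformMean_neg_one_zpow.const_mul (-1)
  rw [mul_zero] at hs
  refine hasUniformMean_zero_of_blockSum_eq (u := 1) (B := 1)
    (fun i => by simp [abs_mul, abs_zpow, hW.abs_eq_one]) (by norm_num) hs fun i => ?_
  obtain ⟨h0, h1, h2, h3, h4⟩ := hW.letter_block i
  obtain ⟨s0, s1, s2, s3⟩ := neg_one_zpow_block i
  have hw := hW.sq_eq_one i
  have hs2 := neg_one_zpow_sq i
  rw [blockSum, h4, add_assoc (4 * i) 1 1, add_assoc (4 * i) 2 1]
  norm_num only
  rw [h0, h1, h2, h3, s0, s1, s2, s3]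
  linear_combination (1 - (-1 : ℝ) ^ i - ((-1 : ℝ) ^ i) ^ 2) * hw - hs2

theorem IsRSSequence.hasUniformMean_pair (hW : IsRSSequence W) :
    HasUniformMean (fun i => W i * W (i + 1)) 0 := by
  have hs := hasUniformMean_neg_one_zpow.add (hW.hasUniformMean_signed_pair.const_mul (-1))
  rw [mul_zero, add_zero] at hs
  refine hasUniformMean_zero_of_blockSum_eq (u := 0) (B := 1)
    (fun i => by simp [abs_mul, hW.abs_eq_one]) (by norm_num) hs fun i => ?_
  obtain ⟨h0, h1, h2, h3, h4⟩ := hW.letter_block i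
  have hw := hW.sq_eq_one i
  have hs2 := neg_one_zpow_sq i
  rw [blockSum, h4, add_assoc (4 * i) 1 1, add_assoc (4 * i) 2 1]
  norm_num only
  rw [h0, h1, h2, h3]
  linear_combination (1 + (-1 : ℝ) ^ i - ((-1 : ℝ) ^ i) ^ 2) * hw - hs2

end Window

/-- Monomials in `W i` and `W (i + 1)`: as squares of signs are `1`, there are eight of them. -/
theorem IsRSSequence.exists_hasUniformMean_of_window_one {W : ℤ → ℝ} (hW : IsRSSequence W)
    {ι : Type} (S : Finset ι) (p : ι → ℤ) (σ : ℕ) (hp : ∀ k ∈ S, 0 ≤ p k ∧ p k ≤ 1) :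
    ∃ c, HasUniformMean (rsMonomial W S p σ) c := by
  classical
  obtain ⟨a, b, e⟩ : ∃ a b : ℕ, ∀ i, ∏ k ∈ S, W (i + p k) = W i ^ a * W (i + 1) ^ b := by
    refine ⟨(S.filter fun k => p k = 0).card, (S.filter fun k => ¬ p k = 0).card, fun i => ?_⟩
    rw [← Finset.prod_const, ← Finset.prod_const, ← Finset.prod_ite]
    refine Finset.prod_congr rfl fun k hk => ?_
    split_ifs with h
    · rw [h, add_zero]
    · rw [show p k = 1 by have := hp k hk; omega]
  have e' : rsMonomial W S p σ = fun i => (if Even σ then 1 else (-1) ^ i) *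
      ((if Even a then 1 else W i) * (if Even b then 1 else W (i + 1))) := by
    funext i
    rw [rsMonomial, e, pow_eq_ite_of_sq_eq_one (neg_one_zpow_sq i),
      pow_eq_ite_of_sq_eq_one (hW.sq_eq_one i), pow_eq_ite_of_sq_eq_one (hW.sq_eq_one (i + 1))]
  rw [e']
  by_cases h1 : Even σ <;> by_cases h2 : Even a <;> by_cases h3 : Even b <;>
    simp only [h1, h2, h3, if_true, if_false, one_mul, mul_one]
  · exact ⟨1, hasUniformMean_const 1⟩
  · exact ⟨0, hW.hasUniformMean_letter.translate 1⟩
  · exact ⟨0, hW.hasUniformMean_letter⟩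
  · exact ⟨0, hW.hasUniformMean_pair⟩
  · exact ⟨0, hasUniformMean_neg_one_zpow⟩
  · refine ⟨-1 * 0, ?_⟩
    convert (hW.hasUniformMean_signed_letter.translate 1).const_mul (-1) using 2 with i
    rw [zpow_add_one₀ (by norm_num)]
    ring
  · exact ⟨0, hW.hasUniformMean_signed_letter⟩
  · exact ⟨0, hW.hasUniformMean_signed_pair⟩

/-- Passing to the positions `4 i + j` shortens a window `[0, D]` to `[0, (D + 3) / 4]`, which is
shorter as soon as `2 ≤ D`. -/
theorem IsRSSequence.exists_hasUniformMean_of_window {W : ℤ → ℝ} (hW : IsRSSequence W)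
    {ι : Type} (S : Finset ι) (D : ℕ) : ∀ (p : ι → ℤ) (σ : ℕ),
    (∀ k ∈ S, 0 ≤ p k ∧ p k ≤ D) → ∃ c, HasUniformMean (rsMonomial W S p σ) c := by
  induction D using Nat.strong_induction_on with
  | _ D ih =>
    intro p σ hp
    rcases Nat.lt_or_ge D 2 with hD | hD
    · exact hW.exists_hasUniformMean_of_window_one S p σ fun k hk => by have := hp k hk; omega
    · have h : ∀ j : ℕ, ∃ c, j < 4 → HasUniformMean (rsMonomial W S (fun k => (p k + j) / 4)
          (S.filter fun k => 2 ≤ (p k + j) % 4).card) c := fun j => by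
        by_cases hj : j < 4
        · obtain ⟨c, hc⟩ := ih (D - 1) (by omega) (fun k => (p k + j) / 4)
            (S.filter fun k => 2 ≤ (p k + j) % 4).card
            fun k hk => by have := hp k hk; omega
          exact ⟨c, fun _ => hc⟩
        · exact ⟨0, fun h => absurd h hj⟩
      choose c hc using h
      refine ⟨_, hasUniformMean_of_block (hW.abs_rsMonomial_le S p σ)
        (c := fun j => ((-1) ^ j) ^ σ * (∏ k ∈ S, rsSign (p k + j)) * c j) fun j hj => ?_⟩
      simp only [hW.rsMonomial_four_mul]
      exact (hc j hj).const_mul _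

/-- Every monomial in the letters has a uniform mean. -/
theorem IsRSSequence.exists_hasUniformMean {W : ℤ → ℝ} (hW : IsRSSequence W)
    {ι : Type} (S : Finset ι) (p : ι → ℤ) (σ : ℕ) :
    ∃ c, HasUniformMean (rsMonomial W S p σ) c := by
  obtain ⟨A, hA⟩ : ∃ A : ℕ, ∀ k ∈ S, |p k| ≤ A := by
    refine ⟨(∑ k ∈ S, |p k|).toNat, fun k hk => ?_⟩
    have := Finset.single_le_sum (f := fun k => |p k|) (fun i _ => abs_nonneg _) hk
    omega
  obtain ⟨c, hc⟩ := hW.exists_hasUniformMean_of_window S (2 * A) (fun k => p k + A) σ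
    fun k hk => by have := abs_le.1 (hA k hk); push_cast; omega
  have := ((hc.const_mul (((-1 : ℝ) ^ (A : ℤ)) ^ σ)).translate (-A))
  simp only [← rsMonomial_add, neg_add_cancel_right] at this
  exact ⟨_, this⟩

/-- The mean of a monomial in the letters (an arbitrary number if there is none). -/
noncomputable def rsMean (W : ℤ → ℝ) {ι : Type} (S : Finset ι) (p : ι → ℤ) (σ : ℕ) : ℝ :=
  Classical.epsilon (HasUniformMean (rsMonomial W S p σ))

theorem IsRSSequence.hasUniformMean_rsMean {W : ℤ → ℝ} (hW : IsRSSequence W)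
    {ι : Type} (S : Finset ι) (p : ι → ℤ) (σ : ℕ) :
    HasUniformMean (rsMonomial W S p σ) (rsMean W S p σ) :=
  Classical.epsilon_spec (hW.exists_hasUniformMean S p σ)

/-- The renormalisation equation for the means of monomials. -/
theorem IsRSSequence.rsMean_renorm {W : ℤ → ℝ} (hW : IsRSSequence W) {ι : Type}
    (S : Finset ι) (p : ι → ℤ) (σ : ℕ) :
    rsMean W S p σ = 1 / 4 * ∑ j ∈ Finset.range 4, ((-1) ^ j) ^ σ *
      (∏ k ∈ S, rsSign (p k + (j : ℕ))) * rsMean W S (fun k => (p k + (j : ℕ)) / 4)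
        (S.filter fun k => 2 ≤ (p k + (j : ℕ)) % 4).card := by
  refine (hW.hasUniformMean_rsMean S p σ).unique ?_
  refine hasUniformMean_of_block (hW.abs_rsMonomial_le S p σ) fun j hj => ?_
  simp only [hW.rsMonomial_four_mul]
  exact (hW.hasUniformMean_rsMean _ _ _).const_mul _

theorem IsRSSequence.rsMean_translate {W : ℤ → ℝ} (hW : IsRSSequence W) {ι : Type}
    (S : Finset ι) (p : ι → ℤ) (t : ℤ) :
    rsMean W S (fun k => p k + t) 0 = rsMean W S p 0 := by
  refine (hW.hasUniformMean_rsMean S _ 0).unique ?_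
  have := (hW.hasUniformMean_rsMean S p 0).translate t
  simpa only [rsMonomial_add, pow_zero, one_mul] using this

theorem IsRSSequence.rsMean_singleton {W : ℤ → ℝ} (hW : IsRSSequence W) {ι : Type}
    (k : ι) (p : ι → ℤ) : rsMean W {k} p 0 = 0 := by
  refine (hW.hasUniformMean_rsMean {k} p 0).unique ?_
  have := hW.hasUniformMean_letter.translate (p k)
  convert this using 2 with i
  simp [rsMonomial]

theorem IsRSSequence.rsMean_empty {W : ℤ → ℝ} (hW : IsRSSequence W) {ι : Type}
    (p : ι → ℤ) : rsMean W ∅ p 0 = 1 := by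
  refine (hW.hasUniformMean_rsMean ∅ p 0).unique ?_
  have := hasUniformMean_const 1
  convert this using 2 with i
  simp [rsMonomial]

/-! ### The balanced and the signed correlations -/

theorem corrPos_renormArg {n : ℕ} (m : Fin (n - 1) → ℤ) {j : ℕ} (hj : j < 4) (k : Fin n) :
    corrPos (renormArg m j) k = (corrPos m k + j) / 4 := by
  unfold corrPos renormArg
  split_ifs
  · omega
  · rfl

section Correlations

variable {q : ℤ → Fin 4}

theorem IsRSFixedPoint.tendsto_etaAvg (hq : IsRSFixedPoint q) (n : ℕ) (m : Fin (n - 1) → ℤ) :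
    Tendsto (etaAvg (rsBinary q) n m) atTop
      (𝓝 (rsMean (rsReal q) Finset.univ (corrPos m) 0)) := by
  have := (hq.isRSSequence.hasUniformMean_rsMean Finset.univ (corrPos m) 0).tendsto_avg
  simp only [rsMonomial, pow_zero, one_mul] at this
  exact this

theorem IsRSFixedPoint.tendsto_thetaAvg (hq : IsRSFixedPoint q) (n : ℕ) (m : Fin (n - 1) → ℤ) :
    Tendsto (thetaAvg (rsBinary q) n m) atTop
      (𝓝 (rsMean (rsReal q) Finset.univ (corrPos m) 1)) := by
  have := (hq.isRSSequence.hasUniformMean_rsMean Finset.univ (corrPos m) 1).tendsto_avg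
  simp only [rsMonomial, pow_one] at this
  exact this

theorem IsRSFixedPoint.etaCorr_eq (hq : IsRSFixedPoint q) (n : ℕ) (m : Fin (n - 1) → ℤ) :
    etaCorr (rsBinary q) n m = rsMean (rsReal q) Finset.univ (corrPos m) 0 :=
  (hq.tendsto_etaAvg n m).limUnder_eq

theorem IsRSFixedPoint.thetaCorr_eq (hq : IsRSFixedPoint q) (n : ℕ) (m : Fin (n - 1) → ℤ) :
    thetaCorr (rsBinary q) n m = rsMean (rsReal q) Finset.univ (corrPos m) 1 :=
  (hq.tendsto_thetaAvg n m).limUnder_eq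

theorem rsMean_congr_parity (W : ℤ → ℝ) {ι : Type} (S : Finset ι) (p : ι → ℤ) (σ : ℕ) :
    rsMean W S p σ = if Even σ then rsMean W S p 0 else rsMean W S p 1 := by
  unfold rsMean
  rw [rsMonomial_congr_parity]
  split_ifs <;> rfl

theorem IsRSFixedPoint.isRenormSolution (hq : IsRSFixedPoint q) (n : ℕ) :
    IsRenormSolution n (etaCorr (rsBinary q) n) (thetaCorr (rsBinary q) n) := by
  have key : ∀ (m : Fin (n - 1) → ℤ) (σ : ℕ), rsMean (rsReal q) Finset.univ (corrPos m) σ =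
      1 / 4 * ∑ j ∈ Finset.range 4, ((-1) ^ j) ^ σ * (renormSign m j *
        (if Even (renormTwist m j) then etaCorr (rsBinary q) n (renormArg m j)
          else thetaCorr (rsBinary q) n (renormArg m j))) := fun m σ => by
    rw [hq.isRSSequence.rsMean_renorm]
    congr 1
    refine Finset.sum_congr rfl fun j hj => ?_
    have hpos : (fun k => (corrPos m k + (j : ℕ)) / 4) = corrPos (renormArg m j) :=
      funext fun k => (corrPos_renormArg m (Finset.mem_range.1 hj) k).symm
    rw [hq.etaCorr_eq, hq.thetaCorr_eq, hpos, mul_assoc, rsMean_congr_parity]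
    rfl
  intro m
  constructor
  · rw [hq.etaCorr_eq, key]
    simp only [pow_zero, one_mul]
  · rw [hq.thetaCorr_eq, key]
    simp only [pow_one]

theorem corrPos_zero (n : ℕ) : corrPos (n := n) (fun _ => 0) = fun _ => 0 := by
  funext k
  simp [corrPos]

theorem IsRSFixedPoint.etaCorr_add_two_zero (hq : IsRSFixedPoint q) (k : ℕ) :
    etaCorr (rsBinary q) (k + 2) (fun _ => 0) = etaCorr (rsBinary q) k (fun _ => 0) := by
  rw [hq.etaCorr_eq, hq.etaCorr_eq, corrPos_zero, corrPos_zero]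
  have e : rsMonomial (rsReal q) (Finset.univ : Finset (Fin (k + 2))) (fun _ => 0) 0 =
      rsMonomial (rsReal q) (Finset.univ : Finset (Fin k)) (fun _ => 0) 0 := by
    funext i
    simp [rsMonomial, pow_add, hq.isRSSequence.sq_eq_one]
  rw [rsMean, rsMean, e]

theorem IsRSFixedPoint.isRenormFamily (hq : IsRSFixedPoint q) (n : ℕ) :
    IsRenormFamily n (etaCorr (rsBinary q)) (thetaCorr (rsBinary q)) :=
  ⟨fun k _ _ => hq.isRenormSolution k, fun k _ _ => hq.etaCorr_add_two_zero k⟩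

end Correlations

/-! ### Uniqueness of solutions of the renormalisation equations -/

section Uniqueness

variable {n : ℕ} {G H G' H' : (Fin (n - 1) → ℤ) → ℝ}

theorem IsRenormSolution.sub (h : IsRenormSolution n G H) (h' : IsRenormSolution n G' H') :
    IsRenormSolution n (G - G') (H - H') := by
  intro m
  constructor
  · simp only [Pi.sub_apply]
    rw [(h m).1, (h' m).1, ← mul_sub, ← Finset.sum_sub_distrib]
    congr 1
    refine Finset.sum_congr rfl fun j _ => ?_
    split_ifs <;> ring
  · simp only [Pi.sub_apply]
    rw [(h m).2, (h' m).2, ← mul_sub, ← Finset.sum_sub_distrib]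
    congr 1
    refine Finset.sum_congr rfl fun j _ => ?_
    split_ifs <;> ring

theorem abs_rsSign (a : ℤ) : |rsSign a| = 1 := by
  unfold rsSign
  split_ifs <;> simp [abs_zpow]

theorem abs_renormSign (m : Fin (n - 1) → ℤ) (j : ℕ) : |renormSign m j| = 1 := by
  simp [renormSign, Finset.abs_prod, abs_rsSign]

/-- If only one of the four terms of the renormalisation equations at `m` can be nonzero, and
this term involves no other arguments than `m`, then a solution vanishes at `m`. -/
theorem IsRenormSolution.eq_zero_of_self (h : IsRenormSolution n G H) (m : Fin (n - 1) → ℤ)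
    (j₀ : ℕ) (h₀ : ∀ j < 4, j ≠ j₀ → G (renormArg m j) = 0 ∧ H (renormArg m j) = 0)
    (h₁ : renormArg m j₀ = m) : G m = 0 ∧ H m = 0 := by
  -- The equations bound both `|G m|` and `|H m|` by a quarter of the larger one.
  set M := max |G m| |H m| with hM
  have M0 : 0 ≤ M := (abs_nonneg _).trans (le_max_left _ _)
  have key : ∀ s : ℕ → ℝ, (∀ j, |s j| = 1) → |1 / 4 * ∑ j ∈ Finset.range 4, s j *
      (if Even (renormTwist m j) then G (renormArg m j) else H (renormArg m j))| ≤ 1 / 4 * M := by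
    intro s hs
    rw [abs_mul, abs_of_pos (by norm_num : (0 : ℝ) < 1 / 4)]
    gcongr
    by_cases hj : j₀ ∈ Finset.range 4
    · rw [Finset.sum_eq_single_of_mem j₀ hj]
      · rw [abs_mul, hs, one_mul, h₁]
        split_ifs
        exacts [le_max_left _ _, le_max_right _ _]
      · intro j hj hne
        obtain ⟨a, b⟩ := h₀ j (Finset.mem_range.1 hj) hne
        rw [a, b, ite_self, mul_zero]
    · rw [Finset.sum_eq_zero]
      · simpa using M0
      · intro j hj'
        obtain ⟨a, b⟩ := h₀ j (Finset.mem_range.1 hj') (fun e => hj (e ▸ hj'))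
        rw [a, b, ite_self, mul_zero]
  have hG : |G m| ≤ 1 / 4 * M := by
    rw [(h m).1]
    exact key _ (abs_renormSign m)
  have hH : |H m| ≤ 1 / 4 * M := by
    rw [(h m).2]
    simp only [← mul_assoc]
    exact key (fun j => (-1) ^ j * renormSign m j) fun j => by simp [abs_mul, abs_renormSign]
  have hM' : M ≤ 1 / 4 * M := max_le hG hH
  have : M = 0 := by linarith
  rw [this] at hG hH
  constructor <;> rw [← abs_nonpos_iff] <;> linarith

theorem IsRenormSolution.eq_zero_of_renormArg (h : IsRenormSolution n G H)
    (m : Fin (n - 1) → ℤ) (h₀ : ∀ j < 4, G (renormArg m j) = 0 ∧ H (renormArg m j) = 0) :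
    G m = 0 ∧ H m = 0 := by
  rw [(h m).1, (h m).2]
  constructor <;>
  · refine mul_eq_zero_of_right _ (Finset.sum_eq_zero fun j hj => ?_)
    obtain ⟨a, b⟩ := h₀ j (Finset.mem_range.1 hj)
    simp [a, b]

/-- A solution that vanishes at the origin vanishes everywhere: the equations lead from every
argument to arguments with all entries in `{0, 1}` or all entries in `{-1, 0}`, and from there to
the origin, up to one term that reproduces the argument. -/
theorem IsRenormSolution.eq_zero (h : IsRenormSolution n G H)
    (h0 : G (fun _ => 0) = 0 ∧ H (fun _ => 0) = 0) (m : Fin (n - 1) → ℤ) :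
    G m = 0 ∧ H m = 0 := by
  have hz : ∀ m : Fin (n - 1) → ℤ, (∀ k, m k = 0) → G m = 0 ∧ H m = 0 := fun m hm => by
    rw [show m = fun _ => 0 from funext hm]; exact h0
  have hpos : ∀ m : Fin (n - 1) → ℤ, (∀ k, 0 ≤ m k ∧ m k ≤ 1) → G m = 0 ∧ H m = 0 :=
    fun m hm => h.eq_zero_of_self m 3
      (fun j hj hne => hz _ fun k => by have := hm k; simp only [renormArg]; omega)
      (funext fun k => by have := hm k; simp only [renormArg]; omega)
  have hneg : ∀ m : Fin (n - 1) → ℤ, (∀ k, -1 ≤ m k ∧ m k ≤ 0) → G m = 0 ∧ H m = 0 :=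
    fun m hm => h.eq_zero_of_self m 0
      (fun j hj hne => hz _ fun k => by have := hm k; simp only [renormArg]; omega)
      (funext fun k => by have := hm k; simp only [renormArg]; omega)
  -- From `[-1, 1]`, one step leads into `{-1, 0}` for `j = 0` and into `{0, 1}` for `j > 0`; larger
  -- windows shrink.
  have hall : ∀ D : ℕ, ∀ m : Fin (n - 1) → ℤ, (∀ k, -(D + 1 : ℤ) ≤ m k ∧ m k ≤ D + 1) →
      G m = 0 ∧ H m = 0 := by
    intro D
    induction D with
    | zero =>
      refine fun m hm => h.eq_zero_of_renormArg m fun j hj => ?_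
      rcases Nat.eq_zero_or_pos j with rfl | hj0
      · exact hneg _ fun k => by have := hm k; simp only [renormArg]; omega
      · exact hpos _ fun k => by have := hm k; simp only [renormArg]; omega
    | succ D ih =>
      exact fun m hm => h.eq_zero_of_renormArg m fun j hj => ih _ fun k => by
        have := hm k; simp only [renormArg]; push_cast at this; omega
  refine hall (∑ k, |m k|).toNat m fun k => ?_
  have := Finset.single_le_sum (f := fun k => |m k|) (fun i _ => abs_nonneg _)
    (Finset.mem_univ k)
  have := abs_le.1 (le_refl |m k|)
  omega

theorem renormSign_zero (j : ℕ) : renormSign (n := n) (fun _ => 0) j = rsSign j ^ n := by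
  simp [renormSign, corrPos_zero]

theorem renormTwist_zero (j : ℕ) :
    renormTwist (n := n) (fun _ => 0) j = if 2 ≤ (j : ℤ) % 4 then n else 0 := by
  simp only [renormTwist, corrPos_zero, zero_add]
  split_ifs with h <;> simp [h]

theorem renormArg_zero {j : ℕ} (hj : j < 4) : renormArg (n := n) (fun _ => 0) j = fun _ => 0 := by
  funext k
  simp only [renormArg]
  omega

/-- The renormalisation equations at the origin force both functions to vanish there, except that
they leave `G 0` free for even `n`. -/
theorem IsRenormSolution.origin (h : IsRenormSolution n G H) :
    H (fun _ => 0) = 0 ∧ (¬ Even n → G (fun _ => 0) = 0) := by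
  have h0 := h fun _ => 0
  simp only [Finset.sum_range_succ, Finset.sum_range_zero, renormSign_zero, renormTwist_zero,
    renormArg_zero (show 0 < 4 by norm_num), renormArg_zero (show 1 < 4 by norm_num),
    renormArg_zero (show 2 < 4 by norm_num), renormArg_zero (show 3 < 4 by norm_num)] at h0
  have s3 : rsSign 3 = -1 := by norm_num [rsSign]
  have s2 : rsSign 2 = 1 := by norm_num [rsSign]
  have s1 : rsSign 1 = 1 := by norm_num [rsSign]
  have s0 : rsSign 0 = 1 := by norm_num [rsSign]
  by_cases hn : Even n
  · norm_num [hn, s0, s1, s2, s3, hn.neg_one_pow] at h0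
    exact ⟨h0.2, fun h' => absurd hn h'⟩
  · norm_num [hn, s0, s1, s2, s3, (Nat.not_even_iff_odd.1 hn).neg_one_pow] at h0
    exact ⟨by linarith, fun _ => by linarith⟩

theorem IsRenormSolution.eq_of_origin (h : IsRenormSolution n G H)
    (h' : IsRenormSolution n G' H') (h0 : Even n → G (fun _ => 0) = G' (fun _ => 0)) :
    G = G' := by
  have hs := h.sub h'
  funext m
  have := (hs.eq_zero ⟨?_, hs.origin.1⟩ m).1
  · exact sub_eq_zero.1 this
  · by_cases hn : Even n
    · exact sub_eq_zero.2 (h0 hn)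
    · exact hs.origin.2 hn

end Uniqueness

theorem IsRenormFamily.origin_eq_two {n : ℕ} {G H : ∀ k : ℕ, (Fin (k - 1) → ℤ) → ℝ}
    (h : IsRenormFamily n G H) (l : ℕ) (hl : 2 * l + 2 ≤ n) :
    G (2 * l + 2) (fun _ => 0) = G 2 (fun _ => 0) := by
  induction l with
  | zero => rfl
  | succ l ih => rw [← ih (by omega)]; exact h.2 (2 * l + 2) (by omega) (by omega)

/-- Two renormalisation families of order `n` that agree at the origin for one even order agree in
all orders up to `n`. -/
theorem IsRenormFamily.eq_of_origin {n : ℕ} {G H G' H' : ∀ k : ℕ, (Fin (k - 1) → ℤ) → ℝ}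
    (h : IsRenormFamily n G H) (h' : IsRenormFamily n G' H') {p : ℕ} (hp2 : 2 ≤ p) (hpn : p ≤ n)
    (hp : Even p) (h0 : G p (fun _ => 0) = G' p (fun _ => 0)) {k : ℕ} (hk2 : 2 ≤ k)
    (hkn : k ≤ n) : G k = G' k := by
  refine (h.1 k hk2 hkn).eq_of_origin (h'.1 k hk2 hkn) fun hk => ?_
  obtain ⟨l, rfl⟩ : ∃ l, k = 2 * l + 2 := by
    obtain ⟨l, rfl⟩ := hk; exact ⟨l - 1, by omega⟩
  obtain ⟨r, rfl⟩ : ∃ r, p = 2 * r + 2 := by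
    obtain ⟨r, rfl⟩ := hp; exact ⟨r - 1, by omega⟩
  rw [h.origin_eq_two r hpn, h'.origin_eq_two r hpn] at h0
  rw [h.origin_eq_two l hkn, h'.origin_eq_two l hkn, h0]

/-! ### Measures on the space of binary words -/

instance : MeasurableSingletonClass ℤˣ :=
  ⟨fun u => ⟨{(u : ℤ)}, measurableSet_singleton _, by ext v; simp [Units.ext_iff]⟩⟩

/-- The character `x ↦ ∏_{k ∈ S} x (p k)` of the space of binary words. -/
noncomputable def wordChar {ι : Type} (S : Finset ι) (p : ι → ℤ) (x : ℤ → ℤˣ) : ℝ :=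
  ∏ k ∈ S, ((x (p k) : ℤ) : ℝ)

theorem abs_wordChar {ι : Type} (S : Finset ι) (p : ι → ℤ) (x : ℤ → ℤˣ) :
    |wordChar S p x| = 1 := by
  have : ∀ u : ℤˣ, |((u : ℤ) : ℝ)| = 1 := fun u => by
    rcases Int.units_eq_one_or u with rfl | rfl <;> simp
  simp [wordChar, Finset.abs_prod, this]

theorem continuous_wordChar {ι : Type} (S : Finset ι) (p : ι → ℤ) :
    Continuous (wordChar S p) :=
  continuous_finsetProd _ fun k _ =>
    (continuous_of_discreteTopology (f := fun u : ℤˣ => ((u : ℤ) : ℝ))).comp (continuous_apply (p k))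

theorem integrable_wordChar {ι : Type} (S : Finset ι) (p : ι → ℤ) (μ : Measure (ℤ → ℤˣ))
    [IsFiniteMeasure μ] : Integrable (wordChar S p) μ :=
  Integrable.of_bound (continuous_wordChar S p).measurable.aestronglyMeasurable 1
    (ae_of_all _ fun x => (abs_wordChar S p x).le)

theorem continuous_wordShift (t : ℤ) : Continuous (wordShift t) :=
  continuous_pi fun i => continuous_apply (i + t)

theorem wordShift_wordShift (s t : ℤ) (x : ℤ → ℤˣ) :
    wordShift s (wordShift t x) = wordShift (s + t) x := by
  funext i
  simp [wordShift, add_assoc]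

theorem iterate_wordShift_one (i : ℕ) : (wordShift 1)^[i] = wordShift i := by
  induction i with
  | zero => funext x i; simp [wordShift]
  | succ i ih =>
    funext x
    rw [Function.iterate_succ_apply', ih, wordShift_wordShift]
    congr 1
    push_cast
    ring

theorem wordChar_wordShift {ι : Type} (S : Finset ι) (p : ι → ℤ) (t : ℤ) (x : ℤ → ℤˣ) :
    wordChar S p (wordShift t x) = wordChar S (fun k => p k + t) x := rfl

theorem wordChar_wordShift_eq_rsMonomial {ι : Type} (S : Finset ι) (p : ι → ℤ) (t : ℤ)
    (x : ℤ → ℤˣ) :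
    wordChar S p (wordShift t x) = rsMonomial (fun i => ((x i : ℤ) : ℝ)) S p 0 t := by
  simp [wordChar, wordShift, rsMonomial, add_comm]

/-- The integral of a product of affine functions of single letters, expanded in characters. -/
theorem integral_prod_affine {ι : Type} [DecidableEq ι] (S : Finset ι) (p : ι → ℤ) (a b : ι → ℝ)
    (μ : Measure (ℤ → ℤˣ)) [IsFiniteMeasure μ] :
    ∫ x, ∏ k ∈ S, (a k * ((x (p k) : ℤ) : ℝ) + b k) ∂μ =
      ∑ t ∈ S.powerset, (∏ k ∈ t, a k) * (∏ k ∈ S \ t, b k) * ∫ x, wordChar t p x ∂μ := by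
  have e : ∀ x : ℤ → ℤˣ, ∏ k ∈ S, (a k * ((x (p k) : ℤ) : ℝ) + b k) =
      ∑ t ∈ S.powerset, (∏ k ∈ t, a k) * (∏ k ∈ S \ t, b k) * wordChar t p x := fun x => by
    rw [Finset.prod_add]
    refine Finset.sum_congr rfl fun t _ => ?_
    rw [Finset.prod_mul_distrib, wordChar]
    ring
  simp only [e]
  rw [integral_finsetSum _ fun t _ => (integrable_wordChar t p μ).const_mul _]
  simp only [integral_const_mul]

/-- A probability measure on the space of binary words is determined by its integrals of
characters, as the indicators of cylinders are linear combinations of characters. -/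
theorem measure_eq_of_integral_wordChar {μ ν : Measure (ℤ → ℤˣ)} [IsProbabilityMeasure μ]
    [IsProbabilityMeasure ν]
    (h : ∀ S : Finset ℤ, ∫ x, wordChar S id x ∂μ = ∫ x, wordChar S id x ∂ν) : μ = ν := by
  classical
  have hm : ∀ I : Finset ℤ, Measurable (I.restrict : (ℤ → ℤˣ) → (I → ℤˣ)) :=
    fun I => I.measurable_restrict
  refine IsProjectiveLimit.unique (P := fun I : Finset ℤ => ν.map I.restrict) (fun I => ?_)
    fun I => rfl
  refine Measure.ext_of_singleton fun y => ?_
  rw [Measure.map_apply (hm I) (measurableSet_singleton y),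
    Measure.map_apply (hm I) (measurableSet_singleton y)]
  have hC : MeasurableSet (I.restrict ⁻¹' {y} : Set (ℤ → ℤˣ)) := hm I (measurableSet_singleton y)
  -- The prescribed letters `y` are extended to a word `z`; the indicator of the cylinder is then the
  -- product of the factors `(1 + z i * x i) / 2`.
  obtain ⟨z, hz⟩ : ∃ z : ℤ → ℤˣ, I.restrict z = y :=
    ⟨fun i => if hi : i ∈ I then y ⟨i, hi⟩ else 1, by funext i; simp⟩
  have ind : ∀ x : ℤ → ℤˣ, (I.restrict ⁻¹' {y} : Set (ℤ → ℤˣ)).indicator (1 : (ℤ → ℤˣ) → ℝ) x =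
      ∏ i ∈ I, (((z i : ℤ) : ℝ) / 2 * ((x (id i) : ℤ) : ℝ) + 1 / 2) := fun x => by
    have hf : ∀ u v : ℤˣ, ((u : ℤ) : ℝ) / 2 * ((v : ℤ) : ℝ) + 1 / 2 = if v = u then 1 else 0 := by
      intro u v
      rcases Int.units_eq_one_or u with rfl | rfl <;>
        rcases Int.units_eq_one_or v with rfl | rfl <;> norm_num
    simp only [hf, id, Finset.prod_ite_zero, Finset.prod_const_one, Set.indicator_apply,
      Set.mem_preimage, Set.mem_singleton_iff, Pi.one_apply]
    congr 1
    rw [← hz]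
    simp [funext_iff]
  have real : ∀ ρ : Measure (ℤ → ℤˣ), [IsProbabilityMeasure ρ] →
      ρ.real (I.restrict ⁻¹' {y}) = ∫ x, ∏ i ∈ I,
        (((z i : ℤ) : ℝ) / 2 * ((x (id i) : ℤ) : ℝ) + 1 / 2) ∂ρ := fun ρ _ => by
    rw [← integral_indicator_one hC]
    exact integral_congr_ae (ae_of_all _ ind)
  rw [← measureReal_eq_measureReal_iff, real μ, real ν, integral_prod_affine,
    integral_prod_affine]
  simp only [h]

/-! ### Unique ergodicity -/

theorem measurableSet_wordHull (w : ℤ → ℤˣ) : MeasurableSet (wordHull w) :=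
  isClosed_closure.measurableSet

section UniqueErgodicity

variable {w : ℤ → ℤˣ} {ι : Type} {S : Finset ι} {p : ι → ℤ} {c : ℝ}

/-- Under an invariant probability measure on the hull, a character has its uniform mean along `w`
as integral: the bound for the sums over translates of `w` is a closed condition, so it holds on
the whole hull and can be integrated. -/
theorem IsHullMeasure.integral_wordChar {μ : Measure (ℤ → ℤˣ)} (hμ : IsHullMeasure w μ)
    (hc : HasUniformMean (rsMonomial (fun i => ((w i : ℤ) : ℝ)) S p 0) c) :
    ∫ x, wordChar S p x ∂μ = c := by
  obtain ⟨hprob, hull, hinv⟩ := hμ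
  have hshift : ∀ i : ℕ, ∫ x, wordChar S p (wordShift i x) ∂μ = ∫ x, wordChar S p x ∂μ := by
    intro i
    have hi : MeasurePreserving (wordShift i) μ μ := by
      rw [← iterate_wordShift_one]; exact hinv.iterate i
    conv_rhs => rw [← hi.map_eq]
    exact (integral_map hi.measurable.aemeasurable
      (continuous_wordChar S p).measurable.aestronglyMeasurable).symm
  have hae : ∀ᵐ x ∂μ, x ∈ wordHull w := hull
  refine eq_of_forall_dist_le fun δ hδ => ?_
  obtain ⟨L, hL, hL0⟩ := ((hc.eventually_abs_sum_le hδ).and (eventually_gt_atTop 0)).exists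
  have hcont : Continuous fun x : ℤ → ℤˣ =>
      ∑ i ∈ Finset.range L, wordChar S p (wordShift i x) - c * L :=
    Continuous.sub (continuous_finsetSum _ fun (i : ℕ) _ =>
      (continuous_wordChar S p).comp (continuous_wordShift i)) continuous_const
  have hbound : ∀ x ∈ wordHull w,
      |∑ i ∈ Finset.range L, wordChar S p (wordShift i x) - c * L| ≤ δ * L := by
    have hclosed : IsClosed {x : ℤ → ℤˣ |
        |∑ i ∈ Finset.range L, wordChar S p (wordShift i x) - c * L| ≤ δ * L} :=
      isClosed_le hcont.abs continuous_const
    refine closure_minimal ?_ hclosed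
    rintro _ ⟨a, rfl⟩
    change |∑ i ∈ Finset.range L, wordChar S p (wordShift i (wordShift a w)) - c * L| ≤ δ * L
    simp only [wordShift_wordShift, wordChar_wordShift_eq_rsMonomial]
    simpa only [add_comm] using hL a
  have hint : ∀ i : ℕ, Integrable (fun x => wordChar S p (wordShift i x)) μ := fun i =>
    integrable_wordChar S (fun k => p k + i) μ
  have h1 := norm_integral_le_of_norm_le_const (μ := μ)
    (f := fun x => ∑ i ∈ Finset.range L, wordChar S p (wordShift i x) - c * L) (hae.mono hbound)
  rw [integral_sub (integrable_finsetSum _ fun i _ => hint i) (integrable_const _),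
    integral_finsetSum _ fun i _ => hint i] at h1
  simp only [hshift, Finset.sum_const, Finset.card_range, integral_const, probReal_univ,
    nsmul_eq_mul, smul_eq_mul, one_mul, mul_one] at h1
  have hLpos : (0 : ℝ) < L := by exact_mod_cast hL0
  rw [mul_comm c, ← mul_sub, Real.norm_eq_abs, abs_mul, abs_of_pos hLpos, mul_comm] at h1
  exact le_of_mul_le_mul_right h1 hLpos

/-- The uniform distribution on the translates of `w` by `0, …, N`. -/
noncomputable def empiricalMeasure (w : ℤ → ℤˣ) (N : ℕ) : Measure (ℤ → ℤˣ) :=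
  ((N : ENNReal) + 1)⁻¹ • ∑ i ∈ Finset.range (N + 1), Measure.dirac (wordShift i w)

instance (w : ℤ → ℤˣ) (N : ℕ) : IsProbabilityMeasure (empiricalMeasure w N) := by
  constructor
  simp only [empiricalMeasure, Measure.smul_apply, Measure.finsetSum_apply, measure_univ,
    Finset.sum_const, Finset.card_range, smul_eq_mul, nsmul_eq_mul, mul_one]
  push_cast
  exact ENNReal.inv_mul_cancel (by simp) (by finiteness)

theorem empiricalMeasure_wordHull (w : ℤ → ℤˣ) (N : ℕ) : empiricalMeasure w N (wordHull w) = 1 := by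
  rw [← prob_compl_eq_zero_iff (measurableSet_wordHull w)]
  simp only [empiricalMeasure, Measure.smul_apply, Measure.finsetSum_apply, smul_eq_mul]
  refine mul_eq_zero_of_right _ (Finset.sum_eq_zero fun i _ => ?_)
  rw [Measure.dirac_apply' _ (measurableSet_wordHull w).compl, Set.indicator_of_notMem]
  exact fun h => h (subset_closure ⟨i, rfl⟩)

theorem integral_empiricalMeasure (w : ℤ → ℤˣ) (N : ℕ) {f : (ℤ → ℤˣ) → ℝ} (hf : Continuous f) :
    ∫ x, f x ∂(empiricalMeasure w N) =
      (∑ i ∈ Finset.range (N + 1), f (wordShift i w)) / (N + 1) := by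
  have hm : StronglyMeasurable f := hf.measurable.stronglyMeasurable
  rw [empiricalMeasure, integral_smul_measure, integral_finsetSum_measure]
  · simp only [integral_dirac' _ _ hm, smul_eq_mul, ENNReal.toReal_inv]
    rw [ENNReal.toReal_add (by simp) (by simp)]
    simp [div_eq_inv_mul]
  · exact fun i _ => integrable_dirac' hm (by simp)

theorem HasUniformMean.tendsto_range {g : ℤ → ℝ} {c : ℝ} (h : HasUniformMean g c) :
    Tendsto (fun N : ℕ => (∑ i ∈ Finset.range (N + 1), g i) / (N + 1)) atTop (𝓝 c) := by
  rw [Metric.tendsto_atTop]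
  intro ε hε
  obtain ⟨L₀, hL₀⟩ := eventually_atTop.1 (h.eventually_abs_sum_le (half_pos hε))
  refine ⟨L₀, fun N hN => ?_⟩
  have h1 := hL₀ (N + 1) (by omega) 0
  simp only [zero_add] at h1
  push_cast at h1
  have hpos : (0 : ℝ) < N + 1 := by positivity
  rw [Real.dist_eq, div_sub' hpos.ne', abs_div, abs_of_pos hpos, div_lt_iff₀ hpos, mul_comm _ c]
  nlinarith

/-- If all characters have uniform means along `w`, then the hull of `w` carries exactly one
invariant probability measure. -/
theorem existsUnique_isHullMeasure
    (h : ∀ S : Finset ℤ, ∀ p : ℤ → ℤ,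
      ∃ c, HasUniformMean (rsMonomial (fun i => ((w i : ℤ) : ℝ)) S p 0) c) :
    ∃! μ : Measure (ℤ → ℤˣ), IsHullMeasure w μ := by
  refine existsUnique_of_exists_of_unique ?_ fun μ ν hμ hν => ?_
  · -- Existence: an accumulation point of the empirical measures, by compactness.
    let P : ℕ → ProbabilityMeasure (ℤ → ℤˣ) := fun N => ⟨empiricalMeasure w N, inferInstance⟩
    let U : Ultrafilter ℕ := hyperfilter ℕ
    obtain ⟨μ, hμ⟩ : ∃ μ, Tendsto P U (𝓝 μ) := ⟨_, (U.map P).le_nhds_lim⟩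
    have key : ∀ (S : Finset ℤ) (p : ℤ → ℤ) (c : ℝ),
        HasUniformMean (rsMonomial (fun i => ((w i : ℤ) : ℝ)) S p 0) c →
        ∫ x, wordChar S p x ∂(μ : Measure (ℤ → ℤˣ)) = c := by
      intro S p c hc
      have h1 := ProbabilityMeasure.tendsto_iff_forall_integral_tendsto.1 hμ
        (BoundedContinuousFunction.mkOfCompact ⟨wordChar S p, continuous_wordChar S p⟩)
      simp only [BoundedContinuousFunction.mkOfCompact_apply, ContinuousMap.coe_mk] at h1
      refine tendsto_nhds_unique h1 ?_
      have h2 := hc.tendsto_range.mono_left Nat.hyperfilter_le_atTop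
      refine h2.congr fun N => ?_
      change _ = ∫ x, wordChar S p x ∂(empiricalMeasure w N)
      rw [integral_empiricalMeasure w N (continuous_wordChar S p)]
      simp only [wordChar_wordShift_eq_rsMonomial]
    have hmeas : Measurable (wordShift 1) := (continuous_wordShift 1).measurable
    refine ⟨μ, inferInstance, ?_, hmeas, ?_⟩
    · rw [prob_compl_eq_zero_iff (measurableSet_wordHull w)]
      have h1 := ProbabilityMeasure.limsup_measure_closed_le_of_tendsto hμ
        (F := wordHull w) isClosed_closure
      have h2 : ∀ N, (P N : Measure (ℤ → ℤˣ)) (wordHull w) = 1 := empiricalMeasure_wordHull w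
      simp only [h2, limsup_const] at h1
      exact le_antisymm prob_le_one h1
    · have : IsProbabilityMeasure ((μ : Measure (ℤ → ℤˣ)).map (wordShift 1)) :=
        Measure.isProbabilityMeasure_map hmeas.aemeasurable
      refine measure_eq_of_integral_wordChar fun S => ?_
      obtain ⟨c, hc⟩ := h S id
      rw [key S id c hc, integral_map hmeas.aemeasurable
        (continuous_wordChar S id).measurable.aestronglyMeasurable]
      simp only [wordChar_wordShift]
      refine key S _ c ?_
      simpa only [rsMonomial_add, pow_zero, one_mul] using hc.translate 1
  · have := hμ.1
    have := hν.1
    refine measure_eq_of_integral_wordChar fun S => ?_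
    obtain ⟨c, hc⟩ := h S id
    rw [hμ.integral_wordChar hc, hν.integral_wordChar hc]

end UniqueErgodicity

/-! ### From balanced to weighted correlations -/

section Weighted

variable {q : ℤ → Fin 4}

theorem corrPos_relPos {k : ℕ} (p : Fin k → ℤ) (hk : 0 < k) (j : Fin k) :
    corrPos (relPos p) j = p j + -p ⟨0, hk⟩ := by
  unfold corrPos relPos
  split_ifs with h
  · rw [show j = ⟨0, hk⟩ from Fin.ext h, add_neg_cancel]
  · rw [← sub_eq_add_neg]
    congr 2
    exact Fin.ext (by simp only; omega)

/-- The brackets of the balanced correlations are the means of the monomials in the letters. -/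
theorem IsRSFixedPoint.corrBracket_eq (hq : IsRSFixedPoint q) {ι : Type} [LinearOrder ι]
    (S : Finset ι) (p : ι → ℤ) :
    corrBracket (etaCorr (rsBinary q)) (fun j : Fin S.card => p (S.orderEmbOfFin rfl j)) =
      rsMean (rsReal q) S p 0 := by
  have hW := hq.isRSSequence
  unfold corrBracket
  split_ifs with h0 h1
  · rw [Finset.card_eq_zero.1 h0, hW.rsMean_empty]
  · obtain ⟨k, rfl⟩ := Finset.card_eq_one.1 h1
    rw [hW.rsMean_singleton]
  · rw [hq.etaCorr_eq]
    have e := funext (corrPos_relPos (fun j : Fin S.card => p (S.orderEmbOfFin rfl j))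
      (Nat.pos_of_ne_zero h0))
    rw [e, hW.rsMean_translate]
    have e' : rsMonomial (rsReal q) Finset.univ
        (fun j : Fin S.card => p (S.orderEmbOfFin rfl j)) 0 = rsMonomial (rsReal q) S p 0 := by
      funext i
      simp only [rsMonomial]
      congr 1
      conv_rhs => rw [← Finset.map_orderEmbOfFin_univ S rfl, Finset.prod_map]
      rfl
    rw [rsMean, rsMean, e']

theorem weight_eq (f : ℤˣ → ℝ) (u : ℤˣ) :
    f u = weightDiff f * ((u : ℤ) : ℝ) + weightMean f := by
  rcases Int.units_eq_one_or u with rfl | rfl <;> simp [weightDiff, weightMean] <;> ring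

theorem IsRSFixedPoint.weightedCorr_eq (hq : IsRSFixedPoint q) {μ : Measure (ℤ → ℤˣ)}
    (hμ : IsHullMeasure (rsBinary q) μ) (f : ℤˣ → ℝ) (n : ℕ) (m : Fin (n - 1) → ℤ) :
    weightedCorr μ f n m = weightedFrom (etaCorr (rsBinary q)) f n m := by
  have := hμ.1
  have e : ∀ x : ℤ → ℤˣ, ∏ k : Fin n, f (x (corrPos m k)) =
      ∏ k : Fin n, (weightDiff f * ((x (corrPos m k) : ℤ) : ℝ) + weightMean f) := fun x =>
    Finset.prod_congr rfl fun k _ => weight_eq f _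
  simp only [weightedCorr, e]
  rw [integral_prod_affine Finset.univ (corrPos m) (fun _ => weightDiff f)
    (fun _ => weightMean f) μ, weightedFrom, Finset.powerset_univ]
  refine Finset.sum_congr rfl fun S _ => ?_
  rw [hq.corrBracket_eq, hμ.integral_wordChar
    (hq.isRSSequence.hasUniformMean_rsMean S (corrPos m) 0), Finset.prod_const,
    Finset.prod_const, Finset.card_sdiff_of_subset (Finset.subset_univ _), Finset.card_univ,
    Fintype.card_fin, mul_comm (weightDiff f ^ _)]

theorem weightedFrom_congr {G G' : ∀ k : ℕ, (Fin (k - 1) → ℤ) → ℝ} {n : ℕ}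
    (h : ∀ k, 2 ≤ k → k ≤ n → G k = G' k) (f : ℤˣ → ℝ) (m : Fin (n - 1) → ℤ) :
    weightedFrom G f n m = weightedFrom G' f n m := by
  refine Finset.sum_congr rfl fun S _ => ?_
  have hS : S.card ≤ n := S.card_le_univ.trans (Fintype.card_fin n).le
  unfold corrBracket
  split_ifs with h0 h1
  · rfl
  · rfl
  · rw [h S.card (by omega) hS]

end Weighted

theorem mainTheorem3 (q : ℤ → Fin 4) (hq : IsRSFixedPoint q) :
    (∃! μ : Measure (ℤ → ℤˣ), IsHullMeasure (rsBinary q) μ) ∧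
    ∀ μ : Measure (ℤ → ℤˣ), IsHullMeasure (rsBinary q) μ →
    ∀ n : ℕ, 2 ≤ n →
      -- the balanced correlation functions exist
      (∀ m : Fin (n - 1) → ℤ,
        Tendsto (etaAvg (rsBinary q) n m) atTop (𝓝 (etaCorr (rsBinary q) n m)) ∧
        Tendsto (thetaAvg (rsBinary q) n m) atTop (𝓝 (thetaCorr (rsBinary q) n m))) ∧
      -- and satisfy the renormalisation equations
      IsRenormFamily n (etaCorr (rsBinary q)) (thetaCorr (rsBinary q)) ∧
      ∀ f : ℤˣ → ℝ,
        -- the weighted correlations are computed from the balanced ones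
        (∀ m : Fin (n - 1) → ℤ,
          weightedCorr μ f n m = weightedFrom (etaCorr (rsBinary q)) f n m) ∧
        -- and are determined by one value at the origin
        (∀ G H : ∀ k : ℕ, (Fin (k - 1) → ℤ) → ℝ, IsRenormFamily n G H →
          ∀ p : ℕ, 2 ≤ p → p ≤ n → Even p →
          G p (fun _ => 0) = etaCorr (rsBinary q) p (fun _ => 0) →
          ∀ m : Fin (n - 1) → ℤ, weightedCorr μ f n m = weightedFrom G f n m) := by
  have hW := hq.isRSSequence
  refine ⟨existsUnique_isHullMeasure fun S p => hW.exists_hasUniformMean S p 0,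
    fun μ hμ n _ => ⟨fun m => ⟨?_, ?_⟩, hq.isRenormFamily n, fun f => ⟨hq.weightedCorr_eq hμ f n,
      fun G H hGH p hp2 hpn hp h0 m => ?_⟩⟩⟩
  · rw [hq.etaCorr_eq]
    exact hq.tendsto_etaAvg n m
  · rw [hq.thetaCorr_eq]
    exact hq.tendsto_thetaAvg n m
  · rw [hq.weightedCorr_eq hμ]
    exact weightedFrom_congr
      (fun k hk2 hkn => ((hq.isRenormFamily n).eq_of_origin hGH hp2 hpn hp h0.symm hk2 hkn)) f m
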